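/- For $x\in\mathbb C^n$ let $\|x\|_p=(\sum_{j}|x_j|^p)^{1/p}$ for $1\le p<\infty$ and $\|x\|_\infty=\max_j|x_j|$, let $\|x\|_0$ be the number of nonzero coefficients of $x$, and let $\sigma_s(x)_1=\inf\{\|x-z\|_1 : z\in\mathbb C^n,\ \|z\|_0\le s\}$. There are universal constants $C,c>0$ such that the following holds. Let $m,n,s$ be natural numbers with $1\le s\le n$, let $1\le p\le\infty$, let $q$ be a real number with $q\ge 2$, let $0<\eta<1$, and suppose that $$m\ \ge\ C\Big(s^{2-2/q}\log(en/s)+\log(\eta^{-1})\Big).$$ Let $A$ be an $m\times n$ standard Gaussian matrix, that is, a random matrix with independent real normally distributed entries with mean zero and variance one. Then, with probability exceeding $1-\eta$, the following holds: for every $\hat x\in\mathbb C^n$, every $\varepsilon$ and every $e\in\mathbb C^m$ with $\|e\|_p\le\varepsilon$, writing $y=A\hat x+e$, every minimizer $x^\#$ of the program $$\min_{z\in\mathbb C^n}\|z\|_1\quad\text{subject to}\quad \|y-Az\|_p\le\varepsilon$$ satisfies, for all real $1\le r\le q$, $$\|\hat x-x^\#\|_r\ \le\ c\Big(s^{1/r-1}\sigma_s(\hat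 x)_1+s^{1/r-1/q}\,\frac{\varepsilon}{m^{1/p}}\Big),$$ where $m^{1/p}=1$ if $p=\infty$. -/

import Mathlib

open MeasureTheory ProbabilityTheory
open scoped ENNReal Matrix

namespace SparseRecovery

/-- The usual `ℓ_p`-norm on `ℂⁿ`, `1 ≤ p ≤ ∞`. -/
noncomputable def lpVecNorm {n : ℕ} (p : ℝ≥0∞) (x : Fin n → ℂ) : ℝ :=
  ‖WithLp.toLp p x‖

/-- The error `σ_s(x)_1` of best `s`-term approximation to `x` in `ℓ_1`: the infimum of
`‖x - z‖_1` over all vectors `z` with at most `s` nonzero coefficients. -/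
noncomputable def bestApproxError {n : ℕ} (s : ℕ) (x : Fin n → ℂ) : ℝ :=
  ⨅ z : {z : Fin n → ℂ // hammingNorm z ≤ s}, lpVecNorm 1 (x - z.1)

/-- A real matrix acting on complex vectors. -/
noncomputable def cMulVec {m n : ℕ} (A : Matrix (Fin m) (Fin n) ℝ) (x : Fin n → ℂ) :
    Fin m → ℂ :=
  A.map (fun a : ℝ => (a : ℂ)) *ᵥ x

/-- The feasible set of the `ℓ_p`-constrained basis pursuit denoising program. -/
def bpdnFeasible {m n : ℕ} (p : ℝ≥0∞) (A : Matrix (Fin m) (Fin n) ℝ) (y : Fin m → ℂ)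
    (ε : ℝ) : Set (Fin n → ℂ) :=
  {z | lpVecNorm p (y - cMulVec A z) ≤ ε}

/-- `x` is a solution (a minimizer) of the program
`min ‖z‖_1` over `z ∈ ℂⁿ` subject to `‖y - A z‖_p ≤ ε`. -/
def IsBPDNSolution {m n : ℕ} (p : ℝ≥0∞) (A : Matrix (Fin m) (Fin n) ℝ) (y : Fin m → ℂ)
    (ε : ℝ) (x : Fin n → ℂ) : Prop :=
  x ∈ bpdnFeasible p A y ε ∧ ∀ z ∈ bpdnFeasible p A y ε, lpVecNorm 1 x ≤ lpVecNorm 1 z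

/-- A standard Gaussian random matrix: its entries are independent real normal random variables
with mean zero and variance one. -/
structure IsStandardGaussianMatrix {m n : ℕ} {Ω : Type*} [MeasurableSpace Ω] (P : Measure Ω)
    (A : Ω → Matrix (Fin m) (Fin n) ℝ) : Prop where
  hasLaw : ∀ i j, HasLaw (fun ω => A ω i j) (gaussianReal 0 1) P
  indep : iIndepFun (fun (ij : Fin m × Fin n) (ω : Ω) => A ω ij.1 ij.2) P

end SparseRecovery

/-! Put R = s^(1-1/q), v = x̂ - x^# and ε' = ε/m^(1/p). Everything rests on one estimate, ‖Av‖_1/m ≥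
a‖v‖_2 - (b/R)‖v‖_1 with b small compared with a, valid for all v at once off an event of
probability below η. The exponent p enters only through ‖w‖_1/m ≤ ‖w‖_p/m^(1/p), which gives
‖Av‖_1/m ≤ 2ε'. Hence R‖v‖_2 is at most a multiple of Rε' plus ‖v‖_1/4. Minimality gives the cone
inequality ‖v‖_1 ≤ 2√s‖v‖_2 + 2σ_s(x̂)_1, and √s ≤ R because q ≥ 2, so both ‖v‖_1 and R‖v‖_2 are
O(σ_s(x̂)_1 + Rε'). As ‖v‖_q ≤ ‖v‖_2, interpolation yields every 1 ≤ r ≤ q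
(`recovery_of_lower_bound`, `rpow_sum_rpow_le`).

For the estimate, fix a sparsity k of order R². For a unit vector u the entries of Au are
independent standard normals, so ‖Au‖_1 is of order m up to probability exponentially small in m.
Nets on all supports and a union bound extend this to k-sparse vectors
(`exists_gaussian_sparse_bounds`); this is where m ≳ R² log(en/s) + log(1/η) is needed. Cutting a
vector into blocks of size k then covers all vectors, at a cost proportional to ‖v‖_1/√k
(`seminorm_ge_of_sparse_bounds`). -/

namespace SparseRecovery

/-! ### Nets of spheres and seminorms controlled on them -/

section Nets

variable {E : Type*} [NormedAddCommGroup E] [NormedSpace ℝ E] [FiniteDimensional ℝ E]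

/-- Volumetric bound for the cardinality of a separated subset of the unit ball. -/
theorem card_le_of_separated {δ : ℝ} (hδ : 0 < δ) (N : Finset E) (hN : ∀ c ∈ N, ‖c‖ ≤ 1)
    (h : ∀ c ∈ N, ∀ d ∈ N, c ≠ d → δ ≤ ‖c - d‖) :
    (N.card : ℝ) ≤ (1 + 2 / δ) ^ Module.finrank ℝ E := by
  borelize E
  let μ : Measure E := Measure.addHaar
  have hδ2 : 0 < δ / 2 := by positivity
  have hρ : 0 < 1 + δ / 2 := by positivity
  have D : Set.PairwiseDisjoint (N : Set E) (fun c => Metric.ball (c : E) (δ / 2)) := by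
    intro c hc d hd hcd
    apply Metric.ball_disjoint_ball
    rw [dist_eq_norm]
    linarith [h c hc d hd hcd]
  have hsub : ⋃ c ∈ N, Metric.ball (c : E) (δ / 2) ⊆ Metric.ball (0 : E) (1 + δ / 2) := by
    refine Set.iUnion₂_subset fun x hx => Metric.ball_subset_ball' ?_
    rw [dist_zero_right]
    linarith [hN x hx]
  have I : (N.card : ℝ≥0∞) * ENNReal.ofReal ((δ / 2) ^ Module.finrank ℝ E) * μ (Metric.ball 0 1) ≤
      ENNReal.ofReal ((1 + δ / 2) ^ Module.finrank ℝ E) * μ (Metric.ball 0 1) := by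
    calc
      _ = μ (⋃ c ∈ N, Metric.ball (c : E) (δ / 2)) := by
        rw [measure_biUnion_finset D fun c _ => measurableSet_ball]
        simp only [μ.addHaar_ball_of_pos _ hδ2, Finset.sum_const, nsmul_eq_mul, mul_assoc]
      _ ≤ μ (Metric.ball (0 : E) (1 + δ / 2)) := measure_mono hsub
      _ = _ := by simp only [μ.addHaar_ball_of_pos _ hρ]
  have J : (N.card : ℝ≥0∞) * ENNReal.ofReal ((δ / 2) ^ Module.finrank ℝ E) ≤
      ENNReal.ofReal ((1 + δ / 2) ^ Module.finrank ℝ E) :=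
    (ENNReal.mul_le_mul_iff_left (Metric.measure_ball_pos _ _ zero_lt_one).ne'
      measure_ball_lt_top.ne).1 I
  have K := ENNReal.toReal_le_of_le_ofReal (pow_nonneg hρ.le _) J
  rw [ENNReal.toReal_mul, ENNReal.toReal_natCast, ENNReal.toReal_ofReal (by positivity),
    ← le_div_iff₀ (by positivity), ← div_pow] at K
  rwa [show (1 + δ / 2) / (δ / 2) = 1 + 2 / δ by field_simp; ring] at K

/-- The unit sphere of a `d`-dimensional space has a `δ`-net with at most `(1 + 2 / δ) ^ d`
elements. -/
theorem exists_sphere_net (E : Type*) [NormedAddCommGroup E] [NormedSpace ℝ E]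
    [FiniteDimensional ℝ E] {δ : ℝ} (hδ : 0 < δ) :
    ∃ N : Finset E, (∀ u ∈ N, ‖u‖ = 1) ∧ (∀ x : E, ‖x‖ = 1 → ∃ u ∈ N, ‖x - u‖ ≤ δ) ∧
      (N.card : ℝ) ≤ (1 + 2 / δ) ^ Module.finrank ℝ E := by
  classical
  by_contra! hcon
  -- A separated set obeys the volumetric bound, so by assumption it is not a net and can be
  -- enlarged; separated sets of every size would then exist.
  have key : ∀ j : ℕ, ∃ N : Finset E, N.card = j ∧ (∀ u ∈ N, ‖u‖ = 1) ∧
      ∀ c ∈ N, ∀ d ∈ N, c ≠ d → δ ≤ ‖c - d‖ := by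
    intro j
    induction j with
    | zero => exact ⟨∅, by simp⟩
    | succ j ih =>
      obtain ⟨N, hc, h1, hsep⟩ := ih
      have hcard := card_le_of_separated hδ N (fun c hc => (h1 c hc).le) hsep
      have hnot : ¬ ∀ x : E, ‖x‖ = 1 → ∃ u ∈ N, ‖x - u‖ ≤ δ :=
        fun hx => absurd hcard (not_le.2 (hcon N h1 hx))
      push Not at hnot
      obtain ⟨x, hx1, hx⟩ := hnot
      have hxN : x ∉ N := fun hmem => by
        have := hx x hmem
        simp at this
        linarith
      refine ⟨insert x N, by rw [Finset.card_insert_of_notMem hxN, hc], ?_, ?_⟩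
      · intro u hu
        rcases Finset.mem_insert.1 hu with rfl | hu
        exacts [hx1, h1 u hu]
      · intro c hc d hd hcd
        rcases Finset.mem_insert.1 hc with rfl | hcN <;>
          rcases Finset.mem_insert.1 hd with rfl | hdN
        · exact absurd rfl hcd
        · exact (hx d hdN).le
        · rw [norm_sub_rev]; exact (hx c hcN).le
        · exact hsep c hcN d hdN hcd
  obtain ⟨j, hj⟩ := exists_nat_gt ((1 + 2 / δ) ^ Module.finrank ℝ E)
  obtain ⟨N, hc, h1, hsep⟩ := key j
  have := card_le_of_separated hδ N (fun c hc => (h1 c hc).le) hsep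
  rw [hc] at this
  linarith

/-- Two-sided bounds for a seminorm on a net of the unit sphere extend to the whole space. -/
theorem seminorm_bounds_of_net (f : Seminorm ℝ E) {N : Finset E} {δ α β : ℝ}
    (hδ : δ ≤ 1 / 2) (hδβ : 4 * δ * β ≤ α) (hβ : 0 ≤ β)
    (hN : ∀ x : E, ‖x‖ = 1 → ∃ u ∈ N, ‖x - u‖ ≤ δ)
    (hf : ∀ u ∈ N, α ≤ f u ∧ f u ≤ β) (x : E) :
    α / 2 * ‖x‖ ≤ f x ∧ f x ≤ 2 * β * ‖x‖ := by
  rcases subsingleton_or_nontrivial E with hE | hE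
  · simp [Subsingleton.elim x 0]
  have hcont : Continuous f := continuousOn_univ.1 (f.convexOn.continuousOn isOpen_univ)
  obtain ⟨x₀, hx₀, hmax⟩ := (isCompact_sphere (0 : E) 1).exists_isMaxOn
    (NormedSpace.sphere_nonempty.2 zero_le_one) hcont.continuousOn
  have hle : ∀ y : E, f y ≤ f x₀ * ‖y‖ := by
    intro y
    by_cases hy : y = 0
    · simp [hy]
    have hy0 : 0 < ‖y‖ := norm_pos_iff.2 hy
    have h1 : f (‖y‖⁻¹ • y) ≤ f x₀ := hmax (by simp [norm_smul, hy0.ne'])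
    rw [map_smul_eq_mul, norm_inv, norm_norm, inv_mul_le_iff₀ hy0] at h1
    linarith
  have hx₀1 : ‖x₀‖ = 1 := by simpa using hx₀
  -- The maximum M on the sphere satisfies M ≤ β + δM ≤ β + M/2.
  have hM : f x₀ ≤ 2 * β := by
    obtain ⟨u, hu, hxu⟩ := hN x₀ hx₀1
    have h1 : f x₀ ≤ f u + f (x₀ - u) := by
      simpa using map_add_le_add f u (x₀ - u)
    have h2 := hle (x₀ - u)
    have h3 : f x₀ * ‖x₀ - u‖ ≤ f x₀ * (1 / 2) :=
      mul_le_mul_of_nonneg_left (hxu.trans hδ) (apply_nonneg f _)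
    linarith [(hf u hu).2]
  refine ⟨?_, (hle x).trans (mul_le_mul_of_nonneg_right hM (norm_nonneg _))⟩
  by_cases hx : x = 0
  · simp [hx]
  have hx0 : 0 < ‖x‖ := norm_pos_iff.2 hx
  obtain ⟨u, hu, hxu⟩ := hN (‖x‖⁻¹ • x) (by simp [norm_smul, hx0.ne'])
  have h1 : f u ≤ f (‖x‖⁻¹ • x) + f (‖x‖⁻¹ • x - u) := by
    have := map_add_le_add f (‖x‖⁻¹ • x) (u - ‖x‖⁻¹ • x)
    rwa [add_sub_cancel, map_sub_rev f u] at this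
  -- This error is at most α/2 by `hδβ`, which leaves half of the lower bound at u.
  have h2 : f (‖x‖⁻¹ • x - u) ≤ 2 * β * δ :=
    (hle _).trans (mul_le_mul hM hxu (norm_nonneg _) (by positivity))
  have h3 : α / 2 ≤ f (‖x‖⁻¹ • x) := by linarith [(hf u hu).1]
  rw [map_smul_eq_mul, norm_inv, norm_norm, le_inv_mul_iff₀ hx0] at h3
  linarith

end Nets

/-! ### From sparse vectors to all vectors -/

section Shelling

theorem sqrt_mul_div {k : ℝ} (hk : 0 < k) (a : ℝ) : √k * (a / k) = a / √k := by
  have h : √k ≠ 0 := (Real.sqrt_pos.2 hk).ne'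
  rw [mul_div_assoc', div_eq_div_iff hk.ne' h]
  linear_combination a * Real.mul_self_sqrt hk.le

variable {ι : Type*} [DecidableEq ι]

/-- A set of `k` indices of `U` carrying the largest values of `g`. -/
theorem exists_largest_subset (g : ι → ℝ) (U : Finset ι) {k : ℕ} (hk : k ≤ U.card) :
    ∃ T ⊆ U, T.card = k ∧ ∀ i ∈ T, ∀ j ∈ U \ T, g j ≤ g i := by
  induction k with
  | zero => exact ⟨∅, by simp⟩
  | succ k ih =>
    obtain ⟨T, hTU, hc, hT⟩ := ih (by omega)
    have hne : (U \ T).Nonempty := by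
      rw [← Finset.card_pos, Finset.card_sdiff_of_subset hTU]
      omega
    obtain ⟨a, ha, hmax⟩ := Finset.exists_max_image (U \ T) g hne
    have ha' := Finset.mem_sdiff.1 ha
    refine ⟨insert a T, Finset.insert_subset ha'.1 hTU,
      by rw [Finset.card_insert_of_notMem ha'.2, hc], ?_⟩
    intro i hi j hj
    have hj' : j ∈ U \ T := by
      simp only [Finset.mem_sdiff, Finset.mem_insert, not_or] at hj ⊢
      exact ⟨hj.1, hj.2.2⟩
    rcases Finset.mem_insert.1 hi with rfl | hi
    exacts [hmax j hj', hT i hi j hj']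

/-- The restriction of a vector to a set of indices. -/
noncomputable def restrict {𝕜 : Type*} [Zero 𝕜] (T : Finset ι) (x : ι → 𝕜) : ι → 𝕜 :=
  fun i => if i ∈ T then x i else 0

theorem restrict_add_restrict_sdiff {T U : Finset ι} (h : T ⊆ U) (x : ι → ℝ) :
    restrict T x + restrict (U \ T) x = restrict U x := by
  ext i
  by_cases hT : i ∈ T
  · simp [restrict, hT, h hT]
  · simp [restrict, hT]

theorem sum_sq_restrict [Fintype ι] (T : Finset ι) (x : ι → ℝ) :
    ∑ i, restrict T x i ^ 2 = ∑ i ∈ T, x i ^ 2 := by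
  simp [restrict, ite_pow, Finset.sum_ite_mem]

theorem card_mul_le_sum {κ : Type*} {g : κ → ℝ} {T V : Finset κ} (h : ∀ i ∈ T, ∀ j ∈ V, g j ≤ g i) {j : κ}
    (hj : j ∈ V) : (T.card : ℝ) * g j ≤ ∑ i ∈ T, g i := by
  rw [← nsmul_eq_mul]
  exact Finset.card_nsmul_le_sum T g _ fun i hi => h i hi j hj

/-- An upper bound for a seminorm on `k`-sparse vectors yields a mixed `ℓ_∞`-`ℓ_1` bound. -/
theorem seminorm_le_of_sparse_bound (f : Seminorm ℝ (ι → ℝ)) {k : ℕ} (hk : 1 ≤ k) {β : ℝ}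
    (hβ : 0 ≤ β)
    (hf : ∀ (T : Finset ι), T.card ≤ k → ∀ x : ι → ℝ,
      f (restrict T x) ≤ β * √(∑ i ∈ T, x i ^ 2)) (x : ι → ℝ) :
    ∀ (N : ℕ) (U : Finset ι), U.card ≤ N → ∀ M : ℝ, 0 ≤ M → (∀ i ∈ U, |x i| ≤ M) →
      f (restrict U x) ≤ β * (√k * M + (∑ i ∈ U, |x i|) / √k) := by
  have hk0 : (0 : ℝ) < k := by exact_mod_cast hk
  have hsk : 0 < √(k : ℝ) := Real.sqrt_pos.2 hk0
  have hsmall : ∀ T : Finset ι, T.card ≤ k → ∀ M : ℝ, 0 ≤ M → (∀ i ∈ T, |x i| ≤ M) →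
      f (restrict T x) ≤ β * (√k * M) := by
    intro T hT M hM hTM
    refine (hf T hT x).trans (mul_le_mul_of_nonneg_left ?_ hβ)
    rw [← Real.sqrt_sq hM, ← Real.sqrt_mul hk0.le]
    refine Real.sqrt_le_sqrt ?_
    calc ∑ i ∈ T, x i ^ 2 ≤ T.card • M ^ 2 := Finset.sum_le_card_nsmul _ _ _ fun i hi => by
            rw [← sq_abs]; exact pow_le_pow_left₀ (abs_nonneg _) (hTM i hi) 2
      _ ≤ k * M ^ 2 := by
            rw [nsmul_eq_mul]
            exact mul_le_mul_of_nonneg_right (by exact_mod_cast hT) (sq_nonneg _)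
  intro N
  induction N with
  | zero =>
    intro U hU M hM hUM
    refine (hsmall U (by omega) M hM hUM).trans (mul_le_mul_of_nonneg_left ?_ hβ)
    have : 0 ≤ (∑ i ∈ U, |x i|) / √k := by positivity
    linarith
  | succ N ih =>
    intro U hU M hM hUM
    rcases le_or_gt U.card k with h | h
    · refine (hsmall U h M hM hUM).trans (mul_le_mul_of_nonneg_left ?_ hβ)
      have : 0 ≤ (∑ i ∈ U, |x i|) / √k := by positivity
      linarith
    -- Peel off the k largest entries. Their average bounds all remaining entries and replaces M in
    -- the induction; √k times that average is the ℓ_1-mass of the block over √k, so the block costs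
    -- add up to the ℓ_1-norm.
    obtain ⟨T, hTU, hTc, hT⟩ := exists_largest_subset (fun i => |x i|) U h.le
    have h1 := hsmall T hTc.le M hM fun i hi => hUM i (hTU hi)
    have h2 := ih (U \ T) (by rw [Finset.card_sdiff_of_subset hTU]; omega)
      ((∑ i ∈ T, |x i|) / k) (by positivity) (fun j hj => by
        rw [le_div_iff₀ hk0, mul_comm, ← hTc]
        exact card_mul_le_sum hT hj)
    have h3 : √k * ((∑ i ∈ T, |x i|) / k) = (∑ i ∈ T, |x i|) / √k :=
      sqrt_mul_div hk0 _
    have h4 : f (restrict U x) ≤ f (restrict T x) + f (restrict (U \ T) x) := by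
      rw [← restrict_add_restrict_sdiff hTU]; exact map_add_le_add f _ _
    rw [h3] at h2
    have h5 : ∑ i ∈ U, |x i| = ∑ i ∈ T, |x i| + ∑ i ∈ U \ T, |x i| := by
      rw [add_comm, Finset.sum_sdiff hTU]
    calc _ ≤ _ := h4
      _ ≤ _ := add_le_add h1 h2
      _ = _ := by rw [h5]; ring

theorem sqrt_sum_sq_add_le {κ : Type*} (U : Finset κ) (x y : κ → ℝ) :
    √(∑ i ∈ U, (x i + y i) ^ 2) ≤ √(∑ i ∈ U, x i ^ 2) + √(∑ i ∈ U, y i ^ 2) := by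
  have := Real.Lp_add_le U x y (p := 2) one_le_two
  simp only [Real.sqrt_eq_rpow]
  simpa using this

/-- Two-sided bounds for a seminorm on `k`-sparse vectors yield a lower bound on all vectors. -/
theorem seminorm_ge_of_sparse_bounds [Fintype ι] (f : Seminorm ℝ (ι → ℝ)) {k : ℕ} (hk : 1 ≤ k) {α β : ℝ}
    (hα : 0 ≤ α) (hβ : 0 ≤ β)
    (hf : ∀ (T : Finset ι), T.card ≤ k → ∀ x : ι → ℝ,
      α * √(∑ i ∈ T, x i ^ 2) ≤ f (restrict T x) ∧
        f (restrict T x) ≤ β * √(∑ i ∈ T, x i ^ 2)) (x : ι → ℝ) :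
    α * √(∑ i, x i ^ 2) - (α + β) * ((∑ i, |x i|) / √k) ≤ f x := by
  have hk0 : (0 : ℝ) < k := by exact_mod_cast hk
  have hsk : 0 < √(k : ℝ) := Real.sqrt_pos.2 hk0
  have hx : restrict Finset.univ x = x := by ext; simp [restrict]
  rcases le_or_gt (Finset.univ : Finset ι).card k with h | h
  · have h1 := (hf Finset.univ h x).1
    rw [hx] at h1
    have : 0 ≤ (α + β) * ((∑ i, |x i|) / √k) := by positivity
    linarith
  obtain ⟨T, hTU, hTc, hT⟩ := exists_largest_subset (fun i => |x i|) Finset.univ h.le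
  have h5 : ∑ i, |x i| = ∑ i ∈ T, |x i| + ∑ i ∈ Finset.univ \ T, |x i| := by
    rw [add_comm, Finset.sum_sdiff hTU]
  set a := ∑ i ∈ T, |x i| with ha
  set b := ∑ i ∈ Finset.univ \ T, |x i| with hb
  have ha0 : 0 ≤ a := by positivity
  have hb0 : 0 ≤ b := by positivity
  have hj : ∀ j ∈ Finset.univ \ T, |x j| ≤ a / k := fun j hj => by
    rw [le_div_iff₀ hk0, mul_comm, ← hTc]
    exact card_mul_le_sum hT hj
  have h2 := seminorm_le_of_sparse_bound f hk hβ (fun T hT x => (hf T hT x).2) x _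
    (Finset.univ \ T) le_rfl (a / k) (by positivity) hj
  have h3 : √k * (a / k) = a / √k := sqrt_mul_div hk0 a
  rw [h3, ← add_div, ← h5] at h2
  have h4 := (hf T hTc.le x).1
  have h6 : f (restrict T x) ≤ f x + f (restrict (Finset.univ \ T) x) := by
    have := map_sub_le_add f x (restrict (Finset.univ \ T) x)
    rwa [← congrArg (· - restrict (Finset.univ \ T) x) ((restrict_add_restrict_sdiff hTU x).trans hx),
      add_sub_cancel_right] at this
  -- Outside T the entries are at most a/k and sum to b, so their squares sum to at most ab/k.
  have h7 : √(∑ i ∈ Finset.univ \ T, x i ^ 2) ≤ (a + b) / √k := by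
    rw [Real.sqrt_le_left (by positivity), div_pow, Real.sq_sqrt hk0.le, le_div_iff₀ hk0]
    have : ∑ i ∈ Finset.univ \ T, x i ^ 2 ≤ a / k * b := by
      rw [hb, Finset.mul_sum]
      refine Finset.sum_le_sum fun i hi => ?_
      rw [← sq_abs, sq]
      exact mul_le_mul_of_nonneg_right (hj i hi) (abs_nonneg _)
    calc _ ≤ a / k * b * k := mul_le_mul_of_nonneg_right this hk0.le
      _ = a * b := by field_simp
      _ ≤ (a + b) ^ 2 := by nlinarith [mul_nonneg ha0 hb0]
  have h8 : √(∑ i, x i ^ 2) ≤ √(∑ i ∈ T, x i ^ 2) + √(∑ i ∈ Finset.univ \ T, x i ^ 2) := by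
    have := sqrt_sum_sq_add_le Finset.univ (restrict T x) (restrict (Finset.univ \ T) x)
    rw [sum_sq_restrict, sum_sq_restrict] at this
    convert this using 5 with i
    have := congrFun ((restrict_add_restrict_sdiff hTU x).trans hx) i
    simpa using this.symm
  rw [h5]
  have h9 : α * √(∑ i, x i ^ 2) ≤ α * √(∑ i ∈ T, x i ^ 2) + α * ((a + b) / √k) := by
    rw [← mul_add]
    exact mul_le_mul_of_nonneg_left (h8.trans (by linarith)) hα
  rw [h5] at h2
  linarith

end Shelling

/-! ### The image of a fixed vector under a Gaussian matrix -/

section GaussianRows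

variable {m n : ℕ} {Ω : Type*} [MeasurableSpace Ω] {P : Measure Ω}
  {A : Ω → Matrix (Fin m) (Fin n) ℝ}

theorem IsStandardGaussianMatrix.hasGaussianLaw_mulVec (hA : IsStandardGaussianMatrix P A)
    (u : Fin n → ℝ) : HasGaussianLaw (fun ω i => (A ω *ᵥ u) i) P := by
  have h := iIndepFun.hasGaussianLaw
    (X := fun (ij : Fin m × Fin n) (ω : Ω) => A ω ij.1 ij.2)
    (fun ij => (hA.hasLaw ij.1 ij.2).hasGaussianLaw) hA.indep
  let L : (Fin m × Fin n → ℝ) →L[ℝ] (Fin m → ℝ) :=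
    ContinuousLinearMap.pi fun i => ∑ j, u j • ContinuousLinearMap.proj (i, j)
  have hL : (fun ω i => (A ω *ᵥ u) i) = fun ω => L fun ij => A ω ij.1 ij.2 := by
    ext ω i
    simp [L, Matrix.mulVec, dotProduct, mul_comm]
  rw [hL]
  exact h.map_fun L

theorem IsStandardGaussianMatrix.memLp [IsProbabilityMeasure P]
    (hA : IsStandardGaussianMatrix P A) (i : Fin m) (j : Fin n) :
    MemLp (fun ω => A ω i j) 2 P :=
  (hA.hasLaw i j).hasGaussianLaw.memLp_two

theorem IsStandardGaussianMatrix.covariance_mulVec [IsProbabilityMeasure P]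
    (hA : IsStandardGaussianMatrix P A) (u : Fin n → ℝ) (i k : Fin m) :
    cov[fun ω => (A ω *ᵥ u) i, fun ω => (A ω *ᵥ u) k; P] =
      if i = k then ∑ j, u j ^ 2 else 0 := by
  simp only [Matrix.mulVec, dotProduct]
  rw [covariance_fun_sum_fun_sum (fun j => (hA.memLp i j).mul_const _)
    (fun j => (hA.memLp k j).mul_const _)]
  have hcov : ∀ j l, cov[fun ω => A ω i j * u j, fun ω => A ω k l * u l; P] =
      if i = k then (if j = l then u j ^ 2 else 0) else 0 := by
    intro j l
    rw [covariance_mul_const_left, covariance_mul_const_right]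
    by_cases hij : (i, j) = (k, l)
    · obtain ⟨rfl, rfl⟩ := Prod.mk.inj hij
      rw [covariance_self (hA.hasLaw i j).aemeasurable, (hA.hasLaw i j).variance_eq]
      simp [variance_id_gaussianReal, sq]
    · rw [(hA.indep.indepFun hij).covariance_eq_zero (hA.memLp i j) (hA.memLp k l)]
      simp only [Prod.mk.injEq, not_and] at hij
      split_ifs with h1 h2
      · exact absurd h2 (hij h1)
      all_goals simp
  simp only [hcov]
  split_ifs <;> simp

/-- The coordinates are jointly Gaussian, so being uncorrelated is enough. -/
theorem IsStandardGaussianMatrix.iIndepFun_mulVec [IsProbabilityMeasure P]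
    (hA : IsStandardGaussianMatrix P A) (u : Fin n → ℝ) :
    iIndepFun (fun i ω => (A ω *ᵥ u) i) P :=
  (hA.hasGaussianLaw_mulVec u).iIndepFun_of_covariance_eq_zero fun i j hij => by
    rw [hA.covariance_mulVec, if_neg hij]

theorem IsStandardGaussianMatrix.hasLaw_mulVec [IsProbabilityMeasure P]
    (hA : IsStandardGaussianMatrix P A) {u : Fin n → ℝ} (hu : ∑ j, u j ^ 2 = 1) (i : Fin m) :
    HasLaw (fun ω => (A ω *ᵥ u) i) (gaussianReal 0 1) P where
  aemeasurable := ((hA.hasGaussianLaw_mulVec u).eval i).aemeasurable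
  map_eq := by
    have h := (hA.hasGaussianLaw_mulVec u).eval i
    have hmean : ∫ ω, (A ω *ᵥ u) i ∂P = 0 := by
      simp only [Matrix.mulVec, dotProduct]
      rw [integral_finsetSum _ fun j _ => ((hA.memLp i j).integrable one_le_two).mul_const _]
      refine Finset.sum_eq_zero fun j _ => ?_
      rw [integral_mul_const, (hA.hasLaw i j).integral_eq, integral_id_gaussianReal, zero_mul]
    rw [h.map_eq_gaussianReal, hmean, ← covariance_self h.aemeasurable, hA.covariance_mulVec]
    simp [hu]

end GaussianRows

/-! ### Chernoff bounds for sums of absolute normals -/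

section Tails

theorem integrable_exp_mul_abs_gaussianReal (t : ℝ) :
    Integrable (fun x => Real.exp (t * |x|)) (gaussianReal 0 1) :=
  integrable_exp_mul_abs (X := fun x : ℝ => x) (integrable_exp_mul_gaussianReal t)
    (integrable_exp_mul_gaussianReal (-t))

/-- The integrand is below 1 except at the null set {0}. Strictness is what makes the lower tail
decay exponentially. -/
theorem mgf_abs_gaussianReal_lt_one : mgf (fun x => |x|) (gaussianReal 0 1) (-1) < 1 := by
  have hint := integrable_exp_mul_abs_gaussianReal (-1)
  have hpos : 0 < ∫ x, (1 - Real.exp (-1 * |x|)) ∂(gaussianReal 0 1) := by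
    rw [integral_pos_iff_support_of_nonneg]
    · have hs : Function.support (fun x : ℝ => 1 - Real.exp (-1 * |x|)) = {0}ᶜ := by
        ext x
        simp [sub_eq_zero, eq_comm (a := (1 : ℝ))]
      have := nullSingletonClass_gaussianReal (μ := 0) (v := 1) one_ne_zero
      rw [hs, prob_compl_eq_one_sub (measurableSet_singleton _)]
      simp
    · intro x
      simp
    · exact (integrable_const _).sub hint
  rw [integral_sub (integrable_const _) hint] at hpos
  simp only [integral_const, probReal_univ, smul_eq_mul, one_mul, sub_pos] at hpos
  simpa [mgf] using hpos

variable {m : ℕ} {Ω : Type*} [MeasurableSpace Ω] {P : Measure Ω}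

theorem mgf_sum_abs_gaussian {Y : Fin m → Ω → ℝ}
    (hlaw : ∀ i, HasLaw (Y i) (gaussianReal 0 1) P) (hind : iIndepFun Y P) (t : ℝ) :
    mgf (∑ i, fun ω => |Y i ω|) P t = mgf (fun x => |x|) (gaussianReal 0 1) t ^ m := by
  have h2 : iIndepFun (fun i ω => |Y i ω|) P :=
    hind.comp (fun _ x => |x|) fun _ => continuous_abs.measurable
  rw [h2.mgf_sum₀ fun i => continuous_abs.measurable.comp_aemeasurable (hlaw i).aemeasurable]
  have : ∀ i, mgf (fun ω => |Y i ω|) P t = mgf (fun x => |x|) (gaussianReal 0 1) t := fun i =>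
    (hlaw i).integral_comp (f := fun x => Real.exp (t * |x|)) (by fun_prop)
  simp [this]

/-- A non-integrable function has integral 0 by convention, whereas the product formula gives a
positive value. -/
theorem integrable_exp_mul_sum_abs_gaussian [IsProbabilityMeasure P] {Y : Fin m → Ω → ℝ}
    (hlaw : ∀ i, HasLaw (Y i) (gaussianReal 0 1) P) (hind : iIndepFun Y P) (t : ℝ) :
    Integrable (fun ω => Real.exp (t * (∑ i, fun ω => |Y i ω|) ω)) P := by
  by_contra h
  have h1 := mgf_sum_abs_gaussian hlaw hind t
  have h0 : 0 < mgf (fun x => |x|) (gaussianReal 0 1) t :=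
    mgf_pos (integrable_exp_mul_abs_gaussianReal t)
  rw [mgf, integral_undef h] at h1
  exact (pow_pos h0 m).ne h1

/-- The sum of the absolute values of `m` independent standard normal variables is of order `m`
with exponentially high probability. -/
theorem exists_sum_abs_gaussian_tails :
    ∃ α β : ℝ, 0 < α ∧ 0 < β ∧ ∀ (m : ℕ) (Ω : Type*) [MeasurableSpace Ω] (P : Measure Ω)
      [IsProbabilityMeasure P] (Y : Fin m → Ω → ℝ),
      (∀ i, HasLaw (Y i) (gaussianReal 0 1) P) → iIndepFun Y P →
      P.real {ω | ¬ (α * m ≤ ∑ i, |Y i ω| ∧ ∑ i, |Y i ω| ≤ β * m)} ≤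
        2 * Real.exp (-(min α 1 * m)) := by
  set ρ := mgf (fun x => |x|) (gaussianReal 0 1) (-1) with hρ
  set τ := mgf (fun x => |x|) (gaussianReal 0 1) 1 with hτ
  have hρ0 : 0 < ρ := mgf_pos (integrable_exp_mul_abs_gaussianReal _)
  have hρ1 : ρ < 1 := mgf_abs_gaussianReal_lt_one
  have hτ0 : 0 < τ := mgf_pos (integrable_exp_mul_abs_gaussianReal _)
  have hlog : Real.log ρ < 0 := Real.log_neg hρ0 hρ1
  -- Chernoff at t = -1 gives exp(αm)ρ^m = exp(-αm), since ρ = exp(-2α); at t = 1 the extra 1 in β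
  -- leaves exp(-m).
  refine ⟨-Real.log ρ / 2, |Real.log τ| + 1, by linarith, by positivity, ?_⟩
  intro m Ω _ P _ Y hlaw hind
  set α := -Real.log ρ / 2
  have hlow : P.real {ω | (∑ i, fun ω => |Y i ω|) ω ≤ α * m} ≤ Real.exp (-(α * m)) := by
    refine (measure_le_le_exp_mul_mgf _ (by norm_num)
      (integrable_exp_mul_sum_abs_gaussian hlaw hind (-1))).trans_eq ?_
    rw [mgf_sum_abs_gaussian hlaw hind, ← hρ, ← Real.exp_log hρ0, ← Real.exp_nat_mul,
      ← Real.exp_add]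
    congr 1
    simp only [α]
    ring
  have hup : P.real {ω | (|Real.log τ| + 1) * m ≤ (∑ i, fun ω => |Y i ω|) ω} ≤
      Real.exp (-(1 * m)) := by
    refine (measure_ge_le_exp_mul_mgf _ (by norm_num)
      (integrable_exp_mul_sum_abs_gaussian hlaw hind 1)).trans ?_
    rw [mgf_sum_abs_gaussian hlaw hind, ← hτ, ← Real.exp_log hτ0, ← Real.exp_nat_mul,
      ← Real.exp_add]
    rw [Real.log_exp]
    refine Real.exp_le_exp.2 ?_
    nlinarith [mul_le_mul_of_nonneg_left (le_abs_self (Real.log τ)) (Nat.cast_nonneg (α := ℝ) m)]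
  have hm : (0 : ℝ) ≤ m := Nat.cast_nonneg m
  calc _ ≤ P.real ({ω | (∑ i, fun ω => |Y i ω|) ω ≤ α * m} ∪
        {ω | (|Real.log τ| + 1) * m ≤ (∑ i, fun ω => |Y i ω|) ω}) := by
        refine measureReal_mono fun ω hω => ?_
        simp only [Set.mem_ofPred_eq, not_and_or, not_le, Set.mem_union, Finset.sum_apply] at hω ⊢
        exact hω.imp le_of_lt le_of_lt
    _ ≤ _ := measureReal_union_le _ _
    _ ≤ Real.exp (-(min α 1 * m)) + Real.exp (-(min α 1 * m)) := by
        refine add_le_add (hlow.trans ?_) (hup.trans ?_) <;> refine Real.exp_le_exp.2 ?_ <;>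
          refine neg_le_neg (mul_le_mul_of_nonneg_right ?_ hm)
        exacts [min_le_left _ _, min_le_right _ _]
    _ = _ := by ring

end Tails

/-! ### Uniform bounds on sparse vectors -/

section SparseVectors

/-- The seminorm `x ↦ ‖A x‖_1`. -/
noncomputable def mulVecL1 {m n : ℕ} (A : Matrix (Fin m) (Fin n) ℝ) : Seminorm ℝ (Fin n → ℝ) :=
  Seminorm.of (fun x => ∑ i, |(A *ᵥ x) i|)
    (fun x y => by
      rw [← Finset.sum_add_distrib]
      refine Finset.sum_le_sum fun i _ => ?_
      rw [Matrix.mulVec_add]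
      exact abs_add_le _ _)
    (fun a x => by
      rw [Finset.mul_sum]
      refine Finset.sum_congr rfl fun i _ => ?_
      rw [Matrix.mulVec_smul, Pi.smul_apply, smul_eq_mul, abs_mul, Real.norm_eq_abs])

theorem mulVecL1_apply {m n : ℕ} (A : Matrix (Fin m) (Fin n) ℝ) (x : Fin n → ℝ) :
    mulVecL1 A x = ∑ i, |(A *ᵥ x) i| := rfl

/-- Extension by zero of a vector indexed by a set `S` of coordinates. -/
noncomputable def extendZero {n : ℕ} (S : Finset (Fin n)) :
    EuclideanSpace ℝ S →ₗ[ℝ] (Fin n → ℝ) where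
  toFun u i := if h : i ∈ S then u ⟨i, h⟩ else 0
  map_add' u v := by
    ext i
    by_cases h : i ∈ S <;> simp [h]
  map_smul' a u := by
    ext i
    by_cases h : i ∈ S <;> simp [h]

theorem sum_sq_extendZero {n : ℕ} (S : Finset (Fin n)) (u : EuclideanSpace ℝ S) :
    ∑ i, extendZero S u i ^ 2 = ‖u‖ ^ 2 := by
  rw [EuclideanSpace.norm_sq_eq, ← Finset.sum_subset (Finset.subset_univ S), ← Finset.sum_coe_sort]
  · simp [extendZero]
  · intro i _ hi
    simp [extendZero, hi]

theorem extendZero_restrict {n : ℕ} {S T : Finset (Fin n)} (h : T ⊆ S) (x : Fin n → ℝ) :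
    extendZero S (WithLp.toLp 2 fun i : S => restrict T x i) = restrict T x := by
  ext i
  by_cases hi : i ∈ S
  · simp [extendZero, hi]
  · have hT : i ∉ T := fun hT => hi (h hT)
    simp [extendZero, hi, restrict, hT]

/-- With exponentially high probability `x ↦ ‖A x‖_1 / m` is equivalent to the Euclidean norm on
`d`-sparse vectors, up to the entropy of the set of these vectors. -/
theorem exists_gaussian_sparse_bounds :
    ∃ α β c D : ℝ, 0 < α ∧ 0 < β ∧ 0 < c ∧ 1 ≤ D ∧
      ∀ (m n d : ℕ) (Ω : Type*) [MeasurableSpace Ω] (P : Measure Ω) [IsProbabilityMeasure P]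
        (A : Ω → Matrix (Fin m) (Fin n) ℝ), d ≤ n → IsStandardGaussianMatrix P A →
      ∃ B : Set Ω, P.real B ≤ n.choose d * D ^ d * (2 * Real.exp (-(c * m))) ∧
        ∀ ω ∉ B, ∀ T : Finset (Fin n), T.card ≤ d → ∀ x : Fin n → ℝ,
          α * m * √(∑ i ∈ T, x i ^ 2) ≤ mulVecL1 (A ω) (restrict T x) ∧
            mulVecL1 (A ω) (restrict T x) ≤ β * m * √(∑ i ∈ T, x i ^ 2) := by
  obtain ⟨α, β, hα, hβ, htail⟩ := exists_sum_abs_gaussian_tails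
  set δ : ℝ := min (1 / 2) (α / (4 * β)) with hδ
  have hδ0 : 0 < δ := by positivity
  have hδ1 : δ ≤ 1 / 2 := min_le_left _ _
  have hδβ : 4 * δ * β ≤ α := by
    have : δ ≤ α / (4 * β) := min_le_right _ _
    rw [le_div_iff₀ (by positivity)] at this
    linarith
  refine ⟨α / 2, 2 * β, min α 1, 1 + 2 / δ, by positivity, by positivity, by positivity,
    by linarith [div_pos two_pos hδ0], ?_⟩
  intro m n d Ω _ P _ A hdn hA
  have hm : (0 : ℝ) ≤ m := Nat.cast_nonneg m
  choose N hN1 hN hNc using fun S : Finset (Fin n) => exists_sphere_net (EuclideanSpace ℝ S) hδ0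
  -- The bad event: the tail bound fails at some net point of some support. Supports of size exactly
  -- d suffice, as smaller ones embed in them.
  refine ⟨⋃ S ∈ Finset.powersetCard d Finset.univ, ⋃ u ∈ N S,
    {ω | ¬ (α * m ≤ ∑ i, |(A ω *ᵥ extendZero S u) i| ∧
      ∑ i, |(A ω *ᵥ extendZero S u) i| ≤ β * m)}, ?_, ?_⟩
  · calc _ ≤ ∑ S ∈ Finset.powersetCard d (Finset.univ : Finset (Fin n)),
          ∑ u ∈ N S, 2 * Real.exp (-(min α 1 * m)) := by
          refine (measureReal_biUnion_finset_le _ _).trans (Finset.sum_le_sum fun S _ => ?_)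
          refine (measureReal_biUnion_finset_le _ _).trans (Finset.sum_le_sum fun u hu => ?_)
          have hu1 : ∑ j, extendZero S u j ^ 2 = 1 := by
            rw [sum_sq_extendZero, hN1 S u hu, one_pow]
          exact htail m Ω P _ (fun i => hA.hasLaw_mulVec hu1 i) (hA.iIndepFun_mulVec _)
      _ ≤ ∑ S ∈ Finset.powersetCard d (Finset.univ : Finset (Fin n)),
          (1 + 2 / δ) ^ d * (2 * Real.exp (-(min α 1 * m))) := by
          refine Finset.sum_le_sum fun S hS => ?_
          rw [Finset.sum_const, nsmul_eq_mul]
          have := hNc S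
          rw [finrank_euclideanSpace, Fintype.card_coe, (Finset.mem_powersetCard.1 hS).2] at this
          gcongr
      _ = _ := by
          rw [Finset.sum_const, nsmul_eq_mul, Finset.card_powersetCard, Finset.card_univ,
            Fintype.card_fin, mul_assoc]
  · intro ω hω T hT x
    obtain ⟨S, hTS, hS⟩ := Finset.exists_superset_card_eq hT (by simpa using hdn)
    have hS' : S ∈ Finset.powersetCard d (Finset.univ : Finset (Fin n)) := by
      simp [Finset.mem_powersetCard, hS]
    have hf : ∀ u ∈ N S, α * m ≤ (mulVecL1 (A ω)).comp (extendZero S) u ∧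
        (mulVecL1 (A ω)).comp (extendZero S) u ≤ β * m := by
      intro u hu
      by_contra h
      exact hω (Set.mem_biUnion hS' (Set.mem_biUnion hu h))
    have := seminorm_bounds_of_net ((mulVecL1 (A ω)).comp (extendZero S)) hδ1
      (by nlinarith : 4 * δ * (β * m) ≤ α * m) (by positivity) (hN S) hf
      (WithLp.toLp 2 fun i : S => restrict T x i)
    rw [Seminorm.comp_apply, extendZero_restrict hTS,
      ← Real.sqrt_sq (norm_nonneg (WithLp.toLp 2 fun i : S => restrict T x i)),
      ← sum_sq_extendZero, extendZero_restrict hTS, sum_sq_restrict] at this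
    convert this using 3 <;> ring

end SparseVectors

/-! ### Comparison and interpolation of ℓ_p-norms -/

section Norms

theorem lpVecNorm_one {n : ℕ} (x : Fin n → ℂ) : lpVecNorm 1 x = ∑ i, ‖x i‖ := by
  rw [lpVecNorm, PiLp.norm_eq_sum (by simp)]
  simp

theorem lpVecNorm_ofReal {n : ℕ} {r : ℝ} (hr : 0 < r) (x : Fin n → ℂ) :
    lpVecNorm (ENNReal.ofReal r) x = (∑ i, ‖x i‖ ^ r) ^ (1 / r) := by
  have h : (ENNReal.ofReal r).toReal = r := ENNReal.toReal_ofReal hr.le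
  rw [lpVecNorm, PiLp.norm_eq_sum (by rwa [h]), h]

theorem lpVecNorm_nonneg {n : ℕ} {p : ℝ≥0∞} (hp : 1 ≤ p) (x : Fin n → ℂ) :
    0 ≤ lpVecNorm p x :=
  have : Fact (1 ≤ p) := ⟨hp⟩
  norm_nonneg _

theorem lpVecNorm_sub_le {n : ℕ} {p : ℝ≥0∞} (hp : 1 ≤ p) (x y : Fin n → ℂ) :
    lpVecNorm p (x - y) ≤ lpVecNorm p x + lpVecNorm p y := by
  have : Fact (1 ≤ p) := ⟨hp⟩
  rw [lpVecNorm, WithLp.toLp_sub]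
  exact norm_sub_le _ _

/-- Comparison of the normalized `ℓ_1`- and `ℓ_p`-norms. -/
theorem lpVecNorm_one_le {m : ℕ} (hm : 0 < m) {p : ℝ≥0∞} (hp : 1 ≤ p) (w : Fin m → ℂ) :
    lpVecNorm 1 w ≤ m * (lpVecNorm p w / (m : ℝ) ^ (1 / p).toReal) := by
  have hm0 : (0 : ℝ) < m := by exact_mod_cast hm
  rw [lpVecNorm_one]
  have : Fact (1 ≤ p) := ⟨hp⟩
  rcases eq_or_ne p ⊤ with rfl | htop
  -- For p = ∞ the exponent `(1 / p).toReal` is 0, so the normalizing factor is 1.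
  · simp only [ENNReal.div_top, ENNReal.toReal_zero, Real.rpow_zero, div_one]
    calc ∑ i, ‖w i‖ ≤ ∑ _i : Fin m, lpVecNorm ⊤ w :=
          Finset.sum_le_sum fun i _ => PiLp.norm_apply_le (WithLp.toLp ⊤ w) i
      _ = _ := by simp
  have hp1 : 1 ≤ p.toReal := by
    rw [← ENNReal.toReal_one]
    exact ENNReal.toReal_mono htop hp
  have hp0 : 0 < p.toReal := by linarith
  rw [lpVecNorm, PiLp.norm_eq_sum hp0,
    show (1 / p).toReal = p.toReal⁻¹ by rw [one_div, ENNReal.toReal_inv], one_div]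
  have h1 := Real.rpow_sum_le_const_mul_sum_rpow Finset.univ (fun i => ‖w i‖) hp1
  simp only [Finset.card_univ, Fintype.card_fin, abs_norm] at h1
  have hX : 0 ≤ ∑ i, ‖w i‖ := by positivity
  have h2 := Real.rpow_le_rpow (by positivity) h1 (inv_nonneg.2 hp0.le)
  rw [Real.rpow_rpow_inv hX hp0.ne', Real.mul_rpow (by positivity) (by positivity),
    ← Real.rpow_mul hm0.le, sub_mul, mul_inv_cancel₀ hp0.ne', one_mul, Real.rpow_sub hm0,
    Real.rpow_one] at h2
  refine h2.trans_eq ?_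
  ring

/-- Interpolation between bounds for the `ℓ_1`- and the `ℓ_2`-norm. -/
theorem rpow_sum_rpow_le {n s : ℕ} (hs : 1 ≤ s) {q r B : ℝ} (hq : 2 ≤ q) (hr : 1 ≤ r)
    (hrq : r ≤ q) {a : Fin n → ℝ} (ha : ∀ i, 0 ≤ a i) (h1 : ∑ i, a i ≤ B)
    (h2 : (s : ℝ) ^ (1 - 1 / q) * √(∑ i, a i ^ 2) ≤ B) :
    (∑ i, a i ^ r) ^ (1 / r) ≤ 2 * B * (s : ℝ) ^ (1 / r - 1) := by
  have hs0 : (0 : ℝ) < s := by exact_mod_cast hs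
  have hr0 : 0 < r := by linarith
  have hq0 : 0 < q := by linarith
  have hB : 0 ≤ B := (Finset.sum_nonneg fun i _ => ha i).trans h1
  rcases hB.eq_or_lt with rfl | hB
  · have h0 : ∀ i, a i = 0 := fun i =>
      le_antisymm ((Finset.single_le_sum (fun i _ => ha i) (Finset.mem_univ i)).trans h1) (ha i)
    simp [h0, Real.zero_rpow hr0.ne', Real.zero_rpow (inv_pos.2 hr0).ne']
  set w := √(∑ i, a i ^ 2) with hw
  have hw0 : 0 ≤ w := Real.sqrt_nonneg _
  have haw : ∀ i, a i ≤ w := fun i => by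
    rw [hw]
    refine Real.le_sqrt_of_sq_le ?_
    exact Finset.single_le_sum (f := fun i => a i ^ 2) (fun i _ => sq_nonneg _) (Finset.mem_univ i)
  have hsum : ∑ i, a i ^ 2 = w ^ 2 := (Real.sq_sqrt (by positivity)).symm
  -- This is ‖a‖_q ≤ ‖a‖_2, turning the ℓ_2 hypothesis into an ℓ_q one.
  have hq' : ∑ i, a i ^ q ≤ w ^ q := by
    calc ∑ i, a i ^ q ≤ ∑ i, w ^ (q - 2) * a i ^ 2 := by
          refine Finset.sum_le_sum fun i _ => ?_
          rw [← Real.rpow_two, show a i ^ q = a i ^ (q - 2) * a i ^ (2 : ℝ) by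
            rw [← Real.rpow_add_of_nonneg (ha i) (by linarith) (by norm_num)]; congr 1; ring]
          exact mul_le_mul_of_nonneg_right (Real.rpow_le_rpow (ha i) (haw i) (by linarith))
            (Real.rpow_nonneg (ha i) _)
      _ = w ^ q := by
          rw [← Finset.mul_sum, hsum, ← Real.rpow_two,
            ← Real.rpow_add_of_nonneg hw0 (by linarith) (by norm_num)]
          congr 1
          ring
  -- At the scale t both hypotheses take the same shape: ∑ a ≤ s t and ∑ a^q ≤ s t^q. The pointwise
  -- bound u^r ≤ u + u^q with u = a/t then gives ∑ a^r ≤ 2 s t^r.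
  set t := B / s with ht
  have ht0 : 0 < t := div_pos hB hs0
  have hwq : w ^ q ≤ s * t ^ q := by
    have h3 := Real.rpow_le_rpow (by positivity) h2 hq0.le
    rw [Real.mul_rpow (by positivity) hw0, ← Real.rpow_mul hs0.le, sub_mul,
      one_div_mul_cancel hq0.ne', one_mul, Real.rpow_sub hs0, Real.rpow_one] at h3
    rw [ht, Real.div_rpow hB.le hs0.le]
    have hsq : 0 < (s : ℝ) ^ q := Real.rpow_pos_of_pos hs0 _
    rw [mul_div_assoc', le_div_iff₀ hsq]
    rw [div_mul_eq_mul_div, div_le_iff₀ hs0] at h3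
    linarith
  have hpt : ∀ i, a i ^ r ≤ t ^ r * (a i / t + a i ^ q / t ^ q) := by
    intro i
    have hb : 0 ≤ a i / t := div_nonneg (ha i) ht0.le
    rw [← Real.div_rpow (ha i) ht0.le]
    have : (a i / t) ^ r ≤ a i / t + (a i / t) ^ q := by
      rcases le_total (a i / t) 1 with h | h
      · have h5 := Real.rpow_le_rpow_of_exponent_ge' hb h zero_le_one hr
        rw [Real.rpow_one] at h5
        linarith [Real.rpow_nonneg hb q]
      · linarith [Real.rpow_le_rpow_of_exponent_le h hrq]
    rw [Real.div_rpow (ha i) ht0.le, div_le_iff₀ (Real.rpow_pos_of_pos ht0 r)] at this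
    linarith
  have hfin : ∑ i, a i ^ r ≤ t ^ r * (2 * s) := by
    refine (Finset.sum_le_sum fun i _ => hpt i).trans ?_
    rw [← Finset.mul_sum, Finset.sum_add_distrib, ← Finset.sum_div, ← Finset.sum_div]
    refine mul_le_mul_of_nonneg_left ?_ (Real.rpow_nonneg ht0.le r)
    have h6 : (∑ i, a i) / t ≤ s := by
      rw [div_le_iff₀ ht0, ht, mul_div_cancel₀ _ hs0.ne']; exact h1
    have h7 : (∑ i, a i ^ q) / t ^ q ≤ s := by
      rw [div_le_iff₀ (Real.rpow_pos_of_pos ht0 q)]; exact hq'.trans hwq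
    linarith
  have h8 := Real.rpow_le_rpow (Finset.sum_nonneg fun i _ => Real.rpow_nonneg (ha i) r) hfin
    (one_div_pos.2 hr0).le
  rw [Real.mul_rpow (by positivity) (by positivity), Real.mul_rpow (by norm_num) hs0.le,
    ← Real.rpow_mul ht0.le, mul_one_div_cancel hr0.ne', Real.rpow_one] at h8
  have h9 : (2 : ℝ) ^ (1 / r) ≤ 2 := by
    have := Real.rpow_le_rpow_of_exponent_le (x := 2) (by norm_num) ((div_le_one hr0).2 hr)
    rwa [Real.rpow_one] at this
  refine h8.trans ?_
  rw [Real.rpow_sub hs0, Real.rpow_one, ht]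
  calc B / s * (2 ^ (1 / r) * (s : ℝ) ^ (1 / r)) ≤ B / s * (2 * (s : ℝ) ^ (1 / r)) := by gcongr
    _ = _ := by ring

end Norms

/-! ### Deterministic recovery from the lower bound -/

section Recovery

variable {m n : ℕ}

theorem cMulVec_sub (A : Matrix (Fin m) (Fin n) ℝ) (x y : Fin n → ℂ) :
    cMulVec A (x - y) = cMulVec A x - cMulVec A y :=
  Matrix.mulVec_sub _ _ _

theorem re_cMulVec (A : Matrix (Fin m) (Fin n) ℝ) (x : Fin n → ℂ) (i : Fin m) :
    (cMulVec A x i).re = (A *ᵥ fun j => (x j).re) i := by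
  simp [cMulVec, Matrix.mulVec, dotProduct]

theorem im_cMulVec (A : Matrix (Fin m) (Fin n) ℝ) (x : Fin n → ℂ) (i : Fin m) :
    (cMulVec A x i).im = (A *ᵥ fun j => (x j).im) i := by
  simp [cMulVec, Matrix.mulVec, dotProduct]

/-- A lower bound for `‖A x‖_1` on real vectors carries over to complex vectors. -/
theorem complex_lower_bound (A : Matrix (Fin m) (Fin n) ℝ) {a b : ℝ} (ha : 0 ≤ a) (hb : 0 ≤ b)
    (hA : ∀ x : Fin n → ℝ, a * √(∑ i, x i ^ 2) - b * ∑ i, |x i| ≤ mulVecL1 A x)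
    (v : Fin n → ℂ) :
    a / 2 * √(∑ i, ‖v i‖ ^ 2) - b * ∑ i, ‖v i‖ ≤ lpVecNorm 1 (cMulVec A v) := by
  have h1 := hA fun j => (v j).re
  have h2 := hA fun j => (v j).im
  have h3 : mulVecL1 A (fun j => (v j).re) ≤ lpVecNorm 1 (cMulVec A v) := by
    rw [lpVecNorm_one, mulVecL1_apply]
    exact Finset.sum_le_sum fun i _ => by
      rw [← re_cMulVec]; exact Complex.abs_re_le_norm _
  have h4 : mulVecL1 A (fun j => (v j).im) ≤ lpVecNorm 1 (cMulVec A v) := by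
    rw [lpVecNorm_one, mulVecL1_apply]
    exact Finset.sum_le_sum fun i _ => by
      rw [← im_cMulVec]; exact Complex.abs_im_le_norm _
  have h5 : b * ∑ i, |(v i).re| ≤ b * ∑ i, ‖v i‖ :=
    mul_le_mul_of_nonneg_left (Finset.sum_le_sum fun i _ => Complex.abs_re_le_norm _) hb
  have h6 : b * ∑ i, |(v i).im| ≤ b * ∑ i, ‖v i‖ :=
    mul_le_mul_of_nonneg_left (Finset.sum_le_sum fun i _ => Complex.abs_im_le_norm _) hb
  -- Averaging the real and imaginary estimates costs the factor 1/2 in front of a.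
  have h7 : √(∑ i, ‖v i‖ ^ 2) ≤ √(∑ i, (v i).re ^ 2) + √(∑ i, (v i).im ^ 2) := by
    have : ∑ i, ‖v i‖ ^ 2 = ∑ i, (v i).re ^ 2 + ∑ i, (v i).im ^ 2 := by
      rw [← Finset.sum_add_distrib]
      exact Finset.sum_congr rfl fun i _ => by
        rw [Complex.sq_norm, Complex.normSq_apply, sq, sq]
    rw [this]
    refine (Real.sqrt_le_left (by positivity)).2 ?_
    rw [add_sq, Real.sq_sqrt (by positivity), Real.sq_sqrt (by positivity)]
    have : 0 ≤ 2 * √(∑ i, (v i).re ^ 2) * √(∑ i, (v i).im ^ 2) := by positivity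
    linarith
  have h8 := mul_le_mul_of_nonneg_left h7 ha
  linarith

/-- The cone condition: the error of an `ℓ_1`-minimizer is concentrated on any small set of
coordinates, up to the approximation error. -/
theorem sum_norm_sub_le_of_l1_le {s : ℕ} {x x' z : Fin n → ℂ} (hz : hammingNorm z ≤ s)
    (hx : lpVecNorm 1 x' ≤ lpVecNorm 1 x) :
    ∑ i, ‖(x - x') i‖ ≤ 2 * (√s * √(∑ i, ‖(x - x') i‖ ^ 2)) + 2 * lpVecNorm 1 (x - z) := by
  set v := x - x' with hv
  rw [lpVecNorm_one, lpVecNorm_one] at hx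
  rw [lpVecNorm_one]
  set S : Finset (Fin n) := {i | z i ≠ 0} with hS
  have hSc : S.card ≤ s := hz
  -- After summation the middle term is nonpositive by minimality, and only the sum over S needs
  -- Cauchy–Schwarz.
  have hpt : ∀ i, ‖v i‖ ≤ 2 * (if i ∈ S then ‖v i‖ else 0) + (‖x' i‖ - ‖x i‖) +
      2 * ‖(x - z) i‖ := by
    intro i
    have hvi : v i = x i - x' i := rfl
    split_ifs with h
    · have := norm_sub_norm_le (x i) (x' i)
      rw [← hvi] at this
      linarith [norm_nonneg ((x - z) i)]
    · have hzi : z i = 0 := by simpa [hS] using h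
      have := norm_sub_le (x i) (x' i)
      rw [← hvi] at this
      rw [Pi.sub_apply, hzi, sub_zero]
      linarith
  have hsum := Finset.sum_le_sum fun i (_ : i ∈ Finset.univ) => hpt i
  rw [Finset.sum_add_distrib, Finset.sum_add_distrib, ← Finset.mul_sum, ← Finset.mul_sum,
    Finset.sum_sub_distrib, Finset.sum_ite_mem, Finset.univ_inter] at hsum
  have hCS : ∑ i ∈ S, ‖v i‖ ≤ √s * √(∑ i, ‖v i‖ ^ 2) := by
    rw [← Real.sqrt_mul (Nat.cast_nonneg s)]
    refine Real.le_sqrt_of_sq_le ?_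
    calc (∑ i ∈ S, ‖v i‖) ^ 2 ≤ S.card * ∑ i ∈ S, ‖v i‖ ^ 2 := sq_sum_le_card_mul_sum_sq
      _ ≤ s * ∑ i, ‖v i‖ ^ 2 := by
        gcongr
        exact Finset.subset_univ S
  linarith

/-- Stable and robust recovery by `ℓ_p`-constrained basis pursuit denoising for matrices with a
lower bound for `‖A x‖_1`. -/
theorem recovery_of_lower_bound {s : ℕ} (hs : 1 ≤ s) (hm : 0 < m) {p : ℝ≥0∞} (hp : 1 ≤ p)
    {q α : ℝ} (hq : 2 ≤ q) (hα : 0 < α) (A : Matrix (Fin m) (Fin n) ℝ)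
    (hA : ∀ x : Fin n → ℝ, α * m * √(∑ i, x i ^ 2) -
      α / 8 * m / (s : ℝ) ^ (1 - 1 / q) * ∑ i, |x i| ≤ mulVecL1 A x)
    {x x' : Fin n → ℂ} {e y : Fin m → ℂ} {ε : ℝ} (he : lpVecNorm p e ≤ ε)
    (hy : y = cMulVec A x + e) (hx' : IsBPDNSolution p A y ε x') {r : ℝ} (hr : 1 ≤ r)
    (hrq : r ≤ q) :
    lpVecNorm (ENNReal.ofReal r) (x - x') ≤
      2 * (16 / α + 4) * ((s : ℝ) ^ (1 / r - 1) * bestApproxError s x +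
        (s : ℝ) ^ (1 / r - 1 / q) * (ε / (m : ℝ) ^ (1 / p).toReal)) := by
  have hs0 : (0 : ℝ) < s := by exact_mod_cast hs
  have hs1 : (1 : ℝ) ≤ s := by exact_mod_cast hs
  have hm0 : (0 : ℝ) < m := by exact_mod_cast hm
  have hr0 : 0 < r := by linarith
  set R := (s : ℝ) ^ (1 - 1 / q) with hR
  have hR0 : 0 < R := Real.rpow_pos_of_pos hs0 _
  have hsR : √(s : ℝ) ≤ R := by
    rw [Real.sqrt_eq_rpow]
    refine Real.rpow_le_rpow_of_exponent_le hs1 ?_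
    have : 1 / q ≤ 1 / 2 := one_div_le_one_div_of_le two_pos hq
    linarith
  set ε' := ε / (m : ℝ) ^ (1 / p).toReal with hε'
  have hmp : 0 < (m : ℝ) ^ (1 / p).toReal := Real.rpow_pos_of_pos hm0 _
  have hε0 : 0 ≤ ε' := div_nonneg ((lpVecNorm_nonneg hp e).trans he) hmp.le
  have hfeas : x ∈ bpdnFeasible p A y ε := by
    change lpVecNorm p (y - cMulVec A x) ≤ ε
    rwa [hy, add_sub_cancel_left]
  have hAv : lpVecNorm p (cMulVec A (x - x')) ≤ 2 * ε := by
    have h1 : cMulVec A (x - x') = (y - cMulVec A x') - e := by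
      rw [hy, cMulVec_sub]; abel
    rw [h1]
    have h2 : lpVecNorm p (y - cMulVec A x') ≤ ε := hx'.1
    linarith [lpVecNorm_sub_le hp (y - cMulVec A x') e]
  have hAv1 : lpVecNorm 1 (cMulVec A (x - x')) ≤ m * (2 * ε') := by
    refine (lpVecNorm_one_le hm hp _).trans (mul_le_mul_of_nonneg_left ?_ hm0.le)
    rw [hε', mul_div_assoc']
    exact div_le_div_of_nonneg_right hAv hmp.le
  set V₁ := ∑ i, ‖(x - x') i‖ with hV₁
  set V₂ := √(∑ i, ‖(x - x') i‖ ^ 2) with hV₂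
  have hV₂0 : 0 ≤ V₂ := Real.sqrt_nonneg _
  have hlow : α / 2 * V₂ - α / 8 / R * V₁ ≤ 2 * ε' := by
    have h := (complex_lower_bound A (by positivity) (by positivity) hA (x - x')).trans hAv1
    refine le_of_mul_le_mul_left ?_ hm0
    refine le_trans (le_of_eq ?_) h
    ring
  have hRV : R * V₂ ≤ 4 / α * (R * ε') + V₁ / 4 := by
    have h1 : R * (α / 2 * V₂ - α / 8 / R * V₁) ≤ R * (2 * ε') :=
      mul_le_mul_of_nonneg_left hlow hR0.le
    have h2 : R * (α / 2 * V₂ - α / 8 / R * V₁) = α / 2 * (R * V₂ - V₁ / 4) := by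
      field_simp
      ring
    rw [h2] at h1
    have h3 : R * V₂ - V₁ / 4 ≤ R * (2 * ε') / (α / 2) := by
      rw [le_div_iff₀ (by positivity)]; linarith
    have h4 : R * (2 * ε') / (α / 2) = 4 / α * (R * ε') := by
      field_simp
      ring
    linarith
  have hz : ∀ z : Fin n → ℂ, hammingNorm z ≤ s → lpVecNorm (ENNReal.ofReal r) (x - x') ≤
      2 * (16 / α + 4) * ((s : ℝ) ^ (1 / r - 1) * lpVecNorm 1 (x - z) +
        (s : ℝ) ^ (1 / r - 1 / q) * ε') := by
    intro z hz
    set σ := lpVecNorm 1 (x - z) with hσ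
    have hσ0 : 0 ≤ σ := lpVecNorm_nonneg le_rfl _
    have hcone : V₁ ≤ 2 * (√s * V₂) + 2 * σ := sum_norm_sub_le_of_l1_le hz (hx'.2 x hfeas)
    have h1 : √s * V₂ ≤ R * V₂ := mul_le_mul_of_nonneg_right hsR hV₂0
    have hRε : 0 ≤ R * ε' := by positivity
    have hαpos : 0 < 1 / α := by positivity
    have h16 : 16 / α * (R * ε') = 4 * (4 / α * (R * ε')) := by ring
    have hp1 : 0 ≤ 16 / α * σ := by positivity
    have hp2 : 0 ≤ 4 / α * (R * ε') := by positivity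
    -- Inserting `hRV` into the cone inequality gives V₁ ≤ (8/α)Rε' + V₁/2 + 2σ; the V₁/2 is
    -- absorbed on the left.
    have hB1 : V₁ ≤ (16 / α + 4) * (σ + R * ε') := by
      have h2 : V₁ ≤ 16 / α * (R * ε') + 4 * σ := by linarith
      linarith
    have hB2 : R * V₂ ≤ (16 / α + 4) * (σ + R * ε') := by
      have h2 : V₁ ≤ 16 / α * (R * ε') + 4 * σ := by linarith
      linarith
    rw [lpVecNorm_ofReal hr0]
    refine (rpow_sum_rpow_le hs hq hr hrq (fun i => norm_nonneg _) hB1 hB2).trans_eq ?_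
    have h3 : (s : ℝ) ^ (1 / r - 1 / q) = R * (s : ℝ) ^ (1 / r - 1) := by
      rw [hR, ← Real.rpow_add hs0]
      congr 1
      ring
    rw [h3]
    ring
  set G := 2 * (16 / α + 4) with hG
  have hG0 : 0 < G := by positivity
  set K := (s : ℝ) ^ (1 / r - 1) with hK
  have hK0 : 0 < K := Real.rpow_pos_of_pos hs0 _
  -- Solved for the approximation error, the bound passes to the infimum over z, which need not be
  -- shown to be attained.
  have hinf : (lpVecNorm (ENNReal.ofReal r) (x - x') / G - (s : ℝ) ^ (1 / r - 1 / q) * ε') / K ≤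
      bestApproxError s x := by
    have : Nonempty {z : Fin n → ℂ // hammingNorm z ≤ s} := ⟨⟨0, by simp⟩⟩
    refine le_ciInf fun z => ?_
    rw [div_le_iff₀ hK0, sub_le_iff_le_add, div_le_iff₀ hG0]
    linarith [hz z.1 z.2]
  rw [div_le_iff₀ hK0, sub_le_iff_le_add, div_le_iff₀ hG0] at hinf
  linarith

end Recovery

/-! ### Counting supports and closing the union bound -/

section Entropy

/-- This is the bound (en/d)^d, from d^d/d! ≤ e^d, weakened from d to s to match the logarithm
log(en/s) in the condition on m. -/
theorem choose_le_exp {n d s : ℕ} (hs : 1 ≤ s) (hsd : s ≤ d) (hdn : d ≤ n) :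
    (n.choose d : ℝ) ≤ Real.exp (d * Real.log (Real.exp 1 * n / s)) := by
  have hs0 : (0 : ℝ) < s := by exact_mod_cast hs
  have hd0 : (0 : ℝ) < d := by exact_mod_cast hs.trans hsd
  have hn0 : (0 : ℝ) < n := by exact_mod_cast (hs.trans hsd).trans hdn
  have h1 := Real.pow_div_factorial_le_exp (d : ℝ) hd0.le d
  rw [Real.exp_nat_mul, Real.exp_log (by positivity)]
  calc (n.choose d : ℝ) ≤ n ^ d / d.factorial := Nat.choose_le_pow_div d n
    _ = ((n : ℝ) / d) ^ d * (d ^ d / d.factorial) := by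
        rw [div_pow]; field_simp
    _ ≤ ((n : ℝ) / d) ^ d * Real.exp d := by gcongr
    _ = (Real.exp 1 * n / d) ^ d := by
        rw [← mul_one (d : ℝ), Real.exp_nat_mul, ← mul_pow, mul_one]
        congr 1
        ring
    _ ≤ (Real.exp 1 * n / s) ^ d := by gcongr

theorem union_bound_lt {n d s m : ℕ} {c D H W η : ℝ} (hs : 1 ≤ s) (hsd : s ≤ d) (hdn : d ≤ n)
    (hD : 1 ≤ D) (hη : 0 < η) (hη1 : η < 1) (hW : 1 ≤ W) (hd : d ≤ H * W) (hH : 0 ≤ H)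
    (hc : 0 < c)
    (hm : (2 + H * (1 + Real.log D)) / c *
      (W * Real.log (Real.exp 1 * n / s) + Real.log η⁻¹) ≤ m) :
    n.choose d * D ^ d * (2 * Real.exp (-(c * m))) < η := by
  have hs0 : (0 : ℝ) < s := by exact_mod_cast hs
  have hsn : (s : ℝ) ≤ n := by exact_mod_cast hsd.trans hdn
  have hn0 : (0 : ℝ) < n := hs0.trans_le hsn
  set L := Real.log (Real.exp 1 * n / s) with hL
  have hL1 : 1 ≤ L := by
    rw [hL, Real.le_log_iff_exp_le (div_pos (mul_pos (Real.exp_pos 1) hn0) hs0), mul_div_assoc]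
    exact le_mul_of_one_le_right (Real.exp_pos 1).le ((one_le_div hs0).2 hsn)
  have hlD : 0 ≤ Real.log D := Real.log_nonneg hD
  have hlη : 0 < Real.log η⁻¹ := Real.log_pos ((one_lt_inv₀ hη).2 hη1)
  rw [div_mul_eq_mul_div, div_le_iff₀ hc] at hm
  have hDd : D ^ d = Real.exp (d * Real.log D) := by
    rw [Real.exp_nat_mul, Real.exp_log (by linarith)]
  have h2 : (2 : ℝ) = Real.exp (Real.log 2) := (Real.exp_log two_pos).symm
  have hlog2 : Real.log 2 < 1 := by linarith [Real.log_two_lt_d9]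
  have hWL : 1 ≤ W * L := by nlinarith
  -- In the constant of `hm`, H(1 + log D) pays for supports and nets since L ≥ 1; the summand 2
  -- pays for log 2, as W L ≥ 1, and for log(1/η).
  have key : d * L + d * Real.log D + (Real.log 2 + -(c * m)) < Real.log η := by
    have hlinv : Real.log η⁻¹ = -Real.log η := Real.log_inv η
    have h3 : d * L + d * Real.log D ≤ H * (1 + Real.log D) * (W * L) := by
      calc d * L + d * Real.log D ≤ d * L + d * (Real.log D * L) := by
            have := le_mul_of_one_le_right hlD hL1
            gcongr
        _ = d * ((1 + Real.log D) * L) := by ring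
        _ ≤ H * W * ((1 + Real.log D) * L) := by gcongr
        _ = _ := by ring
    have h4 : 0 ≤ H * (1 + Real.log D) * Real.log η⁻¹ := by positivity
    nlinarith
  calc _ ≤ Real.exp (d * L) * Real.exp (d * Real.log D) *
        (Real.exp (Real.log 2) * Real.exp (-(c * m))) := by
        rw [hDd, ← h2]
        gcongr
        exact choose_le_exp hs hsd hdn
    _ = Real.exp (d * L + d * Real.log D + (Real.log 2 + -(c * m))) := by
        simp only [Real.exp_add]
    _ < Real.exp (Real.log η) := Real.exp_lt_exp.2 key
    _ = η := Real.exp_log hη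

end Entropy

end SparseRecovery

/-! ### Choice of constants and conclusion -/

theorem theorem3p3 :
    ∃ C c : ℝ, 0 < C ∧ 0 < c ∧
      ∀ (m n s : ℕ) (p : ℝ≥0∞) (q η : ℝ),
        1 ≤ s → s ≤ n → 1 ≤ p → 2 ≤ q → 0 < η → η < 1 →
        C * ((s : ℝ) ^ (2 - 2 / q) * Real.log (Real.exp 1 * n / s) + Real.log η⁻¹) ≤ (m : ℝ) →
        ∀ (Ω : Type*) [MeasurableSpace Ω] (P : Measure Ω) [IsProbabilityMeasure P]
          (A : Ω → Matrix (Fin m) (Fin n) ℝ),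
          SparseRecovery.IsStandardGaussianMatrix P A →
          ∃ E : Set Ω, MeasurableSet E ∧ 1 - η < P.real E ∧
            ∀ ω ∈ E, ∀ (xhat : Fin n → ℂ) (e y : Fin m → ℂ) (ε : ℝ),
              SparseRecovery.lpVecNorm p e ≤ ε →
              y = SparseRecovery.cMulVec (A ω) xhat + e →
              ∀ xsharp : Fin n → ℂ, SparseRecovery.IsBPDNSolution p (A ω) y ε xsharp →
                ∀ r : ℝ, 1 ≤ r → r ≤ q →
                  SparseRecovery.lpVecNorm (ENNReal.ofReal r) (xhat - xsharp) ≤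
                    c * ((s : ℝ) ^ (1 / r - 1) * SparseRecovery.bestApproxError s xhat +
                      (s : ℝ) ^ (1 / r - 1 / q) * (ε / (m : ℝ) ^ (1 / p).toReal)) := by
  obtain ⟨α, β, c, D, hα, hβ, hc, hD, hprob⟩ := SparseRecovery.exists_gaussian_sparse_bounds
  have hlD : 0 ≤ Real.log D := Real.log_nonneg hD
  -- Chosen so that (α + β)/(hR) = α/(8R), the coefficient required by `recovery_of_lower_bound`.
  set h : ℝ := 8 * (α + β) / α with hh
  have hh1 : 1 ≤ h := by
    rw [hh, le_div_iff₀ hα]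
    linarith
  refine ⟨(2 + (h ^ 2 + 1) * (1 + Real.log D)) / c, 2 * (16 / α + 4), by positivity,
    by positivity, ?_⟩
  intro m n s p q η hs hsn hp hq hη hη1 hm Ω _ P _ A hA
  have hs0 : (0 : ℝ) < s := by exact_mod_cast hs
  have hs1 : (1 : ℝ) ≤ s := by exact_mod_cast hs
  have hm0 : 0 < m := by
    have hlη : 0 < Real.log η⁻¹ := Real.log_pos ((one_lt_inv₀ hη).2 hη1)
    have hL : 0 ≤ Real.log (Real.exp 1 * n / s) := by
      refine Real.log_nonneg ?_
      rw [one_le_div hs0]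
      have h1 : (s : ℝ) ≤ n := by exact_mod_cast hsn
      have h2 : (1 : ℝ) ≤ Real.exp 1 := Real.one_le_exp zero_le_one
      nlinarith
    have : (0 : ℝ) < m := lt_of_lt_of_le (by positivity) hm
    exact_mod_cast this
  have hmR : (0 : ℝ) < m := by exact_mod_cast hm0
  set R := (s : ℝ) ^ (1 - 1 / q) with hR
  have hR0 : 0 < R := Real.rpow_pos_of_pos hs0 _
  have hRsq : (s : ℝ) ^ (2 - 2 / q) = R ^ 2 := by
    rw [hR, ← Real.rpow_mul_natCast hs0.le]
    congr 1
    push_cast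
    ring
  have hsR : (s : ℝ) ≤ R ^ 2 := by
    rw [← hRsq]
    refine Real.self_le_rpow_of_one_le hs1 ?_
    have : 2 / q ≤ 1 := (div_le_one (by linarith)).2 hq
    linarith
  rw [hRsq] at hm
  set k := ⌈h ^ 2 * R ^ 2⌉₊ with hk
  have hkle : h ^ 2 * R ^ 2 ≤ k := Nat.le_ceil _
  have hklt : (k : ℝ) < h ^ 2 * R ^ 2 + 1 := Nat.ceil_lt_add_one (by positivity)
  have hsk : s ≤ k := by
    have : (s : ℝ) ≤ k :=
      (hsR.trans (le_mul_of_one_le_left (by positivity) (one_le_pow₀ hh1))).trans hkle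
    exact_mod_cast this
  have hdH : ((min k n : ℕ) : ℝ) ≤ (h ^ 2 + 1) * R ^ 2 := by
    have : ((min k n : ℕ) : ℝ) ≤ k := by exact_mod_cast min_le_left k n
    nlinarith
  -- The sparsity k may exceed n; truncating loses nothing because supports have at most n elements.
  obtain ⟨B, hB, hgood⟩ := hprob m n (min k n) Ω P A (min_le_right _ _) hA
  have hBη : P.real B < η := hB.trans_lt <|
    SparseRecovery.union_bound_lt hs (le_min hsk hsn) (min_le_right _ _) hD hη hη1
      (hs1.trans hsR) hdH (by positivity) hc hm
  -- B comes without measurability, so it is replaced by a measurable superset of equal measure.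
  refine ⟨(toMeasurable P B)ᶜ, (measurableSet_toMeasurable P B).compl, ?_, ?_⟩
  · rw [probReal_compl_eq_one_sub (measurableSet_toMeasurable P B), measureReal_def,
      measure_toMeasurable, ← measureReal_def]
    linarith
  intro ω hω x e y ε he hy x' hx' r hr hrq
  have hωB : ω ∉ B := fun hmem => hω (subset_toMeasurable P B hmem)
  refine SparseRecovery.recovery_of_lower_bound hs hm0 hp hq hα (A ω) (fun v => ?_) he hy hx'
    hr hrq
  have hlow := SparseRecovery.seminorm_ge_of_sparse_bounds (SparseRecovery.mulVecL1 (A ω))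
    (hs.trans hsk) (by positivity : 0 ≤ α * m) (by positivity : 0 ≤ β * m)
    (fun T hT => hgood ω hωB T (le_min hT (by simpa using T.card_le_univ))) v
  refine le_trans (sub_le_sub_left ?_ _) hlow
  have hsqrt : h * R ≤ √(k : ℝ) := Real.le_sqrt_of_sq_le (by rw [mul_pow]; exact hkle)
  calc (α * m + β * m) * ((∑ i, |v i|) / √k) ≤ (α * m + β * m) * ((∑ i, |v i|) / (h * R)) := by
        gcongr
    _ = α / 8 * m / R * ∑ i, |v i| := by
        rw [hh]
        field_simp
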